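/- Let $\mathscr{A}_\pi$ be the class of all finite groups $G$ such that any two abelian subgroups of $G$ of equal prime power order are conjugate in $G$, and let $\mathscr{B}_\pi$ be the class of all finite groups $G$ such that any two subgroups of $G$ (abelian or not) of equal prime power order are conjugate in $G$. **Theorem 15.** Let $G \in \mathscr{A}_\pi$ be solvable. Then $G \in \mathscr{B}_\pi$. -/

import Mathlib

open scoped Pointwise

/-- The subgroups `H` and `K` are conjugate in `G`: `K = g H g⁻¹` for some `g` in `G`. -/
def AreConjSubgroups {G : Type*} [Group G] (H K : Subgroup G) : Prop :=
  ∃ g : G, MulAut.conj g • H = K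

/-- The property defining the class `𝒜_π` (for finite groups): any two abelian subgroups of
equal prime power order are conjugate. -/
def IsAPi (G : Type*) [Group G] : Prop :=
  ∀ (p n : ℕ), p.Prime → ∀ H K : Subgroup G, IsMulCommutative H → IsMulCommutative K →
    Nat.card H = p ^ n → Nat.card K = p ^ n → AreConjSubgroups H K

/-- The property defining the class `ℬ_π` (for finite groups): any two subgroups of
equal prime power order are conjugate. -/
def IsBPi (G : Type*) [Group G] : Prop :=
  ∀ (p n : ℕ), p.Prime → ∀ H K : Subgroup G,
    Nat.card H = p ^ n → Nat.card K = p ^ n → AreConjSubgroups H K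

/-! Fix `p` and induct on the order of `G`. A nontrivial normal `q`-subgroup with `q ≠ p` can be
factored out: the hypothesis passes to the quotient and the conclusion comes back by Sylow's
theorem. Otherwise solvability gives a nontrivial abelian normal `p`-subgroup `N`.

If some two commuting elements of order `p` generate a noncyclic group, the hypothesis forbids
elements of order `p ^ 2`. Every nontrivial `p`-element then has order `p` and is conjugate into
`N`, so all `p`-subgroups are abelian (`isMulCommutative_of_not_mem_zpowers`).

Otherwise a Sylow subgroup `P` has at most one subgroup of order `p`. It is cyclic, and again all
`p`-subgroups are abelian, or `p = 2` and `P` is of quaternion type: a cyclic subgroup of index 2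
with only elements of order 4 outside it. In that case a normal 2-subgroup contains an element of
order 4, hence all of them, and this forces `P` to have order at most 8. Subgroups of order at most
4 are abelian and those of order 8 are Sylow, so the conclusion holds. -/

/-! ### Geometric sums and `p`-th powers in metacyclic groups -/

theorem exists_geom_sum_eq_prime_mul {p : ℕ} (hp : p.Prime) {s : ℤ} (hs : (p : ℤ) ∣ s - 1)
    (h2 : p = 2 → (4 : ℤ) ∣ s - 1) :
    ∃ u : ℤ, ∑ j ∈ Finset.range p, s ^ j = p * u ∧ IsCoprime u (p : ℤ) := by
  have key : ∀ v : ℤ, IsCoprime (1 + p * v) (p : ℤ) := fun v => ⟨1, -v, by ring⟩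
  rcases hp.eq_two_or_odd' with rfl | hodd
  · obtain ⟨t, ht⟩ := h2 rfl
    refine ⟨1 + (2 : ℕ) * t, ?_, key t⟩
    simp only [Finset.sum_range_succ, Finset.sum_range_zero]
    push_cast
    linear_combination ht
  · obtain ⟨t, ht⟩ := hs
    have h := odd_sq_dvd_geom_sum₂_sub (R := ℤ) (a := 1) (b := t) hodd
    obtain ⟨v, hv⟩ := h
    refine ⟨1 + p * v, ?_, key v⟩
    have hs' : s = 1 + p * t := by linear_combination ht
    simp only [one_pow, mul_one] at hv
    rw [hs']
    linear_combination hv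

theorem mul_pow_eq_pow_mul_zpow_geom_sum {G : Type*} [Group G] {x b : G} {s : ℤ}
    (h : x * b ^ s = b * x) (k : ℕ) :
    (x * b) ^ k = x ^ k * b ^ (∑ j ∈ Finset.range k, s ^ j) := by
  induction k with
  | zero => simp
  | succ k ih =>
    have h' : ∀ m : ℤ, b ^ m * x = x * b ^ (s * m) := fun m => by
      rw [zpow_mul]; exact ((show SemiconjBy x (b ^ s) b from h).zpow_right m).symm
    rw [pow_succ, ih, geom_sum_succ, mul_assoc, ← mul_assoc _ x b, h', zpow_add, zpow_one, pow_succ]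
    simp only [mul_assoc]

/-- The geometric sum is `p * u` with `u` prime to `p`, so `(x * a ^ i) ^ p = a ^ (p * (m + u *
i))`, and `m + u * i` can be made divisible by `p ^ n`. -/
theorem exists_mul_zpow_pow_eq_one {G : Type*} [Group G] {p : ℕ} (hp : p.Prime) {n : ℕ} {a x : G}
    (ha : orderOf a = p ^ n) {s m : ℤ} (hs : (p : ℤ) ∣ s - 1) (h2 : p = 2 → (4 : ℤ) ∣ s - 1)
    (hx : x * a ^ s = a * x) (hxp : x ^ p = a ^ (p * m)) : ∃ i : ℤ, (x * a ^ i) ^ p = 1 := by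
  obtain ⟨u, hu, hcop⟩ := exists_geom_sum_eq_prime_mul hp hs h2
  obtain ⟨c, d, hcd⟩ := hcop.pow_right (n := n)
  -- `c` inverts `u` modulo `p ^ n`.
  refine ⟨-m * c, ?_⟩
  have hx' : x * (a ^ (-m * c)) ^ s = a ^ (-m * c) * x := by
    rw [← zpow_mul, mul_comm, zpow_mul]
    exact (show SemiconjBy x (a ^ s) a from hx).zpow_right _
  rw [mul_pow_eq_pow_mul_zpow_geom_sum hx', hxp, hu, ← zpow_mul, ← zpow_add]
  apply orderOf_dvd_iff_zpow_eq_one.1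
  rw [ha]
  push_cast
  exact ⟨p * m * d, by linear_combination (-(p * m : ℤ)) * hcd⟩

/-! ### `p`-groups with at most one subgroup of order `p` -/

theorem IsPGroup.exists_mem_center_of_normal {p : ℕ} [Fact p.Prime] {P : Type*} [Group P] [Finite P]
    (hP : IsPGroup p P) (N : Subgroup P) [N.Normal] (hN : N ≠ ⊥) :
    ∃ x ∈ N, orderOf x = p ∧ x ∈ Subgroup.center P := by
  have hP' : IsPGroup p (ConjAct P) := hP
  have hcard : p ∣ Nat.card N := by
    rcases (hP.to_subgroup N).card_eq_or_dvd with h | h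
    · exact absurd (Subgroup.card_eq_one.1 h) hN
    · exact h
  have h1 : (1 : N) ∈ MulAction.fixedPoints (ConjAct P) N := fun g => by
    ext; simp
  obtain ⟨b, hb, hb1⟩ := hP'.exists_fixed_point_of_prime_dvd_card_of_fixed_point N hcard h1
  have hbc : (b : P) ∈ Subgroup.center P := by
    rw [Subgroup.mem_center_iff]
    intro g
    have := congrArg Subtype.val (hb (ConjAct.toConjAct g))
    rw [ConjAct.Subgroup.val_conj_smul, ConjAct.smul_def] at this
    simp only [ConjAct.ofConjAct_toConjAct] at this
    exact mul_inv_eq_iff_eq_mul.1 this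
  have hb1' : (b : P) ≠ 1 := fun h => hb1 (Subtype.ext h.symm)
  have hdvd := hP.dvd_orderOf hb1'
  refine ⟨(b : P) ^ (orderOf (b : P) / p), pow_mem b.2 _, ?_, pow_mem hbc _⟩
  have hpos := orderOf_pos (b : P)
  rw [orderOf_pow_of_dvd (Nat.div_pos (Nat.le_of_dvd hpos hdvd)
    (Fact.out : p.Prime).pos).ne' (Nat.div_dvd_of_dvd hdvd), Nat.div_div_self hdvd hpos.ne']

theorem IsPGroup.exists_central_modulo_of_normal {p : ℕ} [Fact p.Prime] {P : Type*} [Group P]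
    [Finite P] (hP : IsPGroup p P) (A C : Subgroup P) [A.Normal] [C.Normal] (h : ¬ C ≤ A) :
    ∃ x ∈ C, x ∉ A ∧ x ^ p ∈ A ∧ ∀ g : P, (g * x)⁻¹ * (x * g) ∈ A := by
  have hne : C.map (QuotientGroup.mk' A) ≠ ⊥ := by
    rwa [Ne, Subgroup.map_eq_bot_iff, QuotientGroup.ker_mk']
  have : (C.map (QuotientGroup.mk' A)).Normal :=
    Subgroup.Normal.map inferInstance _ (QuotientGroup.mk'_surjective A)
  obtain ⟨_, ⟨x, hxC, rfl⟩, hxp, hxc⟩ := (hP.to_quotient A).exists_mem_center_of_normal _ hne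
  refine ⟨x, hxC, ?_, ?_, ?_⟩
  · intro hxA
    have : (QuotientGroup.mk' A) x = 1 := (QuotientGroup.eq_one_iff x).2 hxA
    rw [this, orderOf_one] at hxp
    exact (Fact.out : p.Prime).one_lt.ne hxp
  · have := pow_orderOf_eq_one ((QuotientGroup.mk' A) x)
    rw [hxp] at this
    exact (QuotientGroup.eq_one_iff _).1 this
  · intro g
    exact QuotientGroup.eq.1 (Subgroup.mem_center_iff.1 hxc (g : P ⧸ A))

/-- If not, pick `x` in `C` outside `⟨a⟩`, central of order `p` modulo `⟨a⟩`, with `x ^ p = a ^ m`.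
If `p ∤ m`, then `⟨x⟩` is a larger cyclic normal subgroup. If `p ∣ m`, correcting `x` by a power of
`a` gives an element of order `p` outside `⟨a⟩`, although `⟨a⟩` already contains the only subgroup
of order `p`. -/
theorem le_zpowers_of_maximal_isCyclic_normal {p : ℕ} [hp : Fact p.Prime] {P : Type*} [Group P]
    [Finite P] (hP : IsPGroup p P)
    (hU : ∀ x y : P, orderOf x = p → orderOf y = p → y ∈ Subgroup.zpowers x)
    {a : P} [hA : (Subgroup.zpowers a).Normal]
    (hmax : ∀ b : P, (Subgroup.zpowers b).Normal → a ∈ Subgroup.zpowers b →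
      b ∈ Subgroup.zpowers a)
    (C : Subgroup P) [C.Normal]
    (hC : ∀ x ∈ C, ∃ s : ℤ, (p : ℤ) ∣ s - 1 ∧ (p = 2 → (4 : ℤ) ∣ s - 1) ∧ x * a ^ s = a * x) :
    C ≤ Subgroup.zpowers a := by
  by_contra hCA
  obtain ⟨x, hxC, hxA, hxp, hxc⟩ := hP.exists_central_modulo_of_normal (Subgroup.zpowers a) C hCA
  obtain ⟨m, hm⟩ := Subgroup.mem_zpowers_iff.1 hxp
  obtain ⟨n, hn⟩ := IsPGroup.iff_orderOf.1 hP a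
  have hax : a ∉ Subgroup.zpowers x := by
    intro h
    -- `⟨x⟩` is normal because it contains `⟨a⟩` and `x` is central modulo `⟨a⟩`.
    refine hxA (hmax x ⟨fun y hy g => ?_⟩ h)
    have hle : Subgroup.zpowers a ≤ Subgroup.zpowers x := by simpa using h
    have hgx : g * x * g⁻¹ ∈ Subgroup.zpowers x := by
      have := hle (hxc g⁻¹)
      have h3 : g * x * g⁻¹ = x * ((g⁻¹ * x)⁻¹ * (x * g⁻¹)) := by group
      rw [h3]
      exact mul_mem (Subgroup.mem_zpowers x) this
    obtain ⟨k, rfl⟩ := hy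
    simp only [← conj_zpow]
    exact zpow_mem hgx k
  have hpm : (p : ℤ) ∣ m := by
    by_contra hpm
    have hcop : IsCoprime m ((p : ℤ) ^ n) :=
      (((Nat.prime_iff_prime_int.1 hp.out).coprime_iff_not_dvd.2 hpm).symm).pow_right
    obtain ⟨c, d, hcd⟩ := hcop
    apply hax
    refine ⟨p * c, ?_⟩
    have h1 : a ^ ((p : ℤ) ^ n) = 1 := by
      rw [← Nat.cast_pow, zpow_natCast, ← hn, pow_orderOf_eq_one]
    calc x ^ ((p : ℤ) * c) = a ^ (c * m) := by
          rw [zpow_mul, zpow_natCast, ← hm, ← zpow_mul, mul_comm]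
      _ = a ^ (c * m + d * (p : ℤ) ^ n) := by rw [zpow_add, mul_comm d, zpow_mul a ((p : ℤ) ^ n), h1]; simp
      _ = a := by rw [hcd, zpow_one]
  obtain ⟨m', rfl⟩ := hpm
  obtain ⟨s, hs, hs2, hxs⟩ := hC x hxC
  obtain ⟨i, hi⟩ := exists_mul_zpow_pow_eq_one hp.out hn hs hs2 hxs hm.symm
  have hxi : x * a ^ i ∉ Subgroup.zpowers a := fun h =>
    hxA ((Subgroup.mul_mem_cancel_right _ (Subgroup.zpow_mem_zpowers a i)).1 h)
  have hA' : Subgroup.zpowers a ≠ ⊥ := by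
    intro h
    have : a = 1 := by simpa using h
    exact hax (this ▸ one_mem _)
  obtain ⟨z, hz, hzp, -⟩ := hP.exists_mem_center_of_normal _ hA'
  have := hU z (x * a ^ i) hzp (orderOf_eq_prime hi fun h => hxi (h ▸ one_mem _))
  exact hxi ((Subgroup.zpowers_le.2 hz) this)

theorem exists_maximal_isCyclic_normal (P : Type*) [Group P] [Finite P] :
    ∃ a : P, (Subgroup.zpowers a).Normal ∧
      ∀ b : P, (Subgroup.zpowers b).Normal → a ∈ Subgroup.zpowers b → b ∈ Subgroup.zpowers a := by
  obtain ⟨a, ha, hmax⟩ := Set.exists_max_image {a : P | (Subgroup.zpowers a).Normal} orderOf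
    (Set.toFinite _) ⟨1, by simp only [Set.mem_ofPred_eq, Subgroup.zpowers_one_eq_bot]; infer_instance⟩
  refine ⟨a, ha, fun b hb hab => ?_⟩
  have hle : Subgroup.zpowers a ≤ Subgroup.zpowers b := by simpa using hab
  have := Subgroup.eq_of_le_of_card_ge hle (by simpa using hmax b hb)
  rw [this]
  exact Subgroup.mem_zpowers b

theorem exists_conj_exponent {P : Type*} [Group P] {a : P} (hA : (Subgroup.zpowers a).Normal)
    (x : P) : ∃ s : ℤ, x * a ^ s = a * x := by
  obtain ⟨s, hs⟩ := hA.conj_mem a (Subgroup.mem_zpowers a) x⁻¹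
  refine ⟨s, ?_⟩
  simp only at hs
  rw [hs]; group

theorem dvd_sub_one_of_commute_zpow {P : Type*} [Group P] {a x : P} {s k : ℤ}
    (hx : x * a ^ s = a * x) (hc : x * a ^ k = a ^ k * x) :
    (orderOf (a ^ k) : ℤ) ∣ s - 1 := by
  have h := ((show SemiconjBy x (a ^ s) a from hx).zpow_right k).eq
  rw [← hc] at h
  have h2 := mul_left_cancel h
  rw [orderOf_dvd_iff_zpow_eq_one, zpow_sub, zpow_one, ← zpow_mul, mul_comm k, zpow_mul, h2,
    mul_inv_cancel]

/-- A nontrivial `⟨a⟩` contains a central element of order `p`, which conjugation by `x` fixes. -/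
theorem IsPGroup.exists_conj_exponent_modEq {p : ℕ} [hp : Fact p.Prime] {P : Type*} [Group P]
    [Finite P] (hP : IsPGroup p P) {a : P} (hA : (Subgroup.zpowers a).Normal) (x : P) :
    ∃ s : ℤ, (p : ℤ) ∣ s - 1 ∧ x * a ^ s = a * x := by
  by_cases h1 : a = 1
  · exact ⟨1, by simp, by simp [h1]⟩
  obtain ⟨s, hs⟩ := exists_conj_exponent hA x
  obtain ⟨z, ⟨k, rfl⟩, hzp, hzc⟩ := hP.exists_mem_center_of_normal (Subgroup.zpowers a)
    (by simpa using h1)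
  refine ⟨s, ?_, hs⟩
  have := dvd_sub_one_of_commute_zpow hs (Subgroup.mem_center_iff.1 hzc x)
  simp only at hzp
  rwa [hzp] at this

theorem IsPGroup.isCyclic_of_odd {p : ℕ} [hp : Fact p.Prime] (h2 : p ≠ 2) {P : Type*} [Group P]
    [Finite P] (hP : IsPGroup p P)
    (hU : ∀ x y : P, orderOf x = p → orderOf y = p → y ∈ Subgroup.zpowers x) : IsCyclic P := by
  obtain ⟨a, hA, hmax⟩ := exists_maximal_isCyclic_normal P
  have := le_zpowers_of_maximal_isCyclic_normal hP hU hmax ⊤ fun x _ => by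
    obtain ⟨s, hs, hx⟩ := hP.exists_conj_exponent_modEq hA x
    exact ⟨s, hs, fun h => absurd h h2, hx⟩
  exact ⟨a, fun x => this (Subgroup.mem_top x)⟩

/-- In a cyclic group `t ^ n = 1` has at most `n` solutions; for `n = orderOf x` the powers of `x`
exhaust them. -/
theorem mem_zpowers_of_orderOf_dvd {G : Type*} [Group G] [Finite G] {a x y : G}
    (hx : x ∈ Subgroup.zpowers a) (hy : y ∈ Subgroup.zpowers a) (h : orderOf y ∣ orderOf x) :
    y ∈ Subgroup.zpowers x := by
  classical
  have := Fintype.ofFinite (Subgroup.zpowers a)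
  have key : ∀ x y : Subgroup.zpowers a, orderOf y ∣ orderOf x → y ∈ Subgroup.zpowers x := by
    intro x y h
    have := Fintype.ofFinite (Subgroup.zpowers x)
    have hsub : (Subgroup.zpowers x : Set (Subgroup.zpowers a)).toFinset ⊆
        Finset.univ.filter fun t => t ^ orderOf x = 1 := by
      rintro t ht
      obtain ⟨k, rfl⟩ := (Set.mem_toFinset.1 ht)
      simp only [Finset.mem_filter, Finset.mem_univ, true_and]
      rw [← zpow_natCast, zpow_comm, zpow_natCast, pow_orderOf_eq_one, one_zpow]
    have heq := Finset.eq_of_subset_of_card_le hsub (by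
      refine (IsCyclic.card_pow_eq_one_le (orderOf_pos x)).trans ?_
      rw [Set.toFinset_card, ← Nat.card_eq_fintype_card]
      exact (Nat.card_zpowers x).ge)
    have hy : y ∈ Finset.univ.filter fun t => t ^ orderOf x = 1 := by
      simpa using orderOf_dvd_iff_pow_eq_one.1 h
    rw [← heq] at hy
    exact Set.mem_toFinset.1 hy
  obtain ⟨k, hk⟩ := key ⟨x, hx⟩ ⟨y, hy⟩ (by simpa [Subgroup.orderOf_mk] using h)
  exact ⟨k, congrArg Subtype.val hk⟩

/-- Let `⟨a⟩` be maximal cyclic normal. If it has an element `w` of order 4, elements centralizing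
`w` act on `a` with exponent `1` modulo 4, so the centralizer of `w` lies in `⟨a⟩`. Everything
outside inverts `w`, which gives index 2. -/
theorem IsPGroup.two_isCyclic_or {P : Type*} [Group P] [Finite P] (hP : IsPGroup 2 P)
    (hU : ∀ x y : P, orderOf x = 2 → orderOf y = 2 → y ∈ Subgroup.zpowers x) :
    IsCyclic P ∨ ∃ a : P, (Subgroup.zpowers a).index = 2 ∧
      (∀ x ∉ Subgroup.zpowers a, orderOf x = 4) := by
  obtain ⟨a, hA, hmax⟩ := exists_maximal_isCyclic_normal P
  by_cases h4 : 4 ∣ orderOf a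
  swap
  · left
    have := le_zpowers_of_maximal_isCyclic_normal hP hU hmax ⊤ fun x _ => by
      obtain ⟨s, hs, hx⟩ := hP.exists_conj_exponent_modEq hA x
      obtain ⟨n, hn⟩ := IsPGroup.iff_orderOf.1 hP a
      have hn1 : n ≤ 1 := by
        by_contra h
        exact h4 (hn ▸ pow_dvd_pow 2 (by omega : 2 ≤ n))
      -- Here `a ^ 2 = 1`, so the odd exponent `s` may be replaced by `1`.
      refine ⟨1, by simp, by simp, ?_⟩
      obtain ⟨t, ht⟩ := hs
      have ha2 : a ^ (2 : ℤ) = 1 := by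
        apply orderOf_dvd_iff_zpow_eq_one.1
        rw [hn]
        exact_mod_cast pow_dvd_pow 2 hn1
      have : s = 1 + 2 * t := by push_cast at ht; linarith
      rw [this, zpow_add, zpow_mul, ha2] at hx
      simpa using hx
    exact ⟨a, fun x => this (Subgroup.mem_top x)⟩
  by_cases hcyc : Subgroup.zpowers a = ⊤
  · exact Or.inl (isCyclic_iff_exists_zpowers_eq_top.2 ⟨a, hcyc⟩)
  right
  obtain ⟨q, hq⟩ := h4
  have hpos := orderOf_pos a
  have hq0 : q ≠ 0 := by rintro rfl; omega
  set w := a ^ q with hw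
  have hw4 : orderOf w = 4 := by
    rw [hw, orderOf_pow_of_dvd hq0 ⟨4, by rw [hq, mul_comm]⟩, hq, Nat.mul_div_cancel _ (by omega)]
  have hwA : w ∈ Subgroup.zpowers a := pow_mem (Subgroup.mem_zpowers a) q
  have hinv : ∀ g : P, g * w * g⁻¹ = w ∨ g * w * g⁻¹ = w⁻¹ := by
    intro g
    classical
    have ho : orderOf (g * w * g⁻¹) = 4 := by
      rw [← hw4]; exact (MulAut.conj g).orderOf_eq w
    have hm := mem_zpowers_of_orderOf_dvd hwA (hA.conj_mem w hwA g) (by rw [ho, hw4])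
    rw [← mem_powers_iff_mem_zpowers, mem_powers_iff_mem_range_orderOf] at hm
    rw [hw4] at hm
    obtain ⟨k, hk, hkw⟩ := Finset.mem_image.1 hm
    simp only [Finset.mem_range] at hk
    have hw4' : w ^ 4 = 1 := hw4 ▸ pow_orderOf_eq_one w
    interval_cases k
    · rw [← hkw] at ho; simp at ho
    · left; rw [← hkw, pow_one]
    · rw [← hkw, orderOf_pow, hw4] at ho; norm_num at ho
    · right; rw [← hkw, eq_inv_iff_mul_eq_one, ← pow_succ, hw4']
  have hW : (Subgroup.zpowers w).Normal := ⟨by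
    rintro _ ⟨k, rfl⟩ g
    simp only [← conj_zpow]
    rcases hinv g with h | h <;> rw [h]
    · exact zpow_mem (Subgroup.mem_zpowers w) k
    · exact zpow_mem (inv_mem (Subgroup.mem_zpowers w)) k⟩
  set C := Subgroup.centralizer (Subgroup.zpowers w : Set P) with hCdef
  have hCn : C.Normal := inferInstance
  have hCmem : ∀ x, x ∈ C ↔ x * w = w * x := fun x => by
    rw [hCdef, Subgroup.mem_centralizer_iff]
    refine ⟨fun h => (h w (Subgroup.mem_zpowers w)).symm, ?_⟩
    rintro h _ ⟨k, rfl⟩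
    exact ((show Commute x w from h).zpow_right k).eq.symm
  have hCle : C ≤ Subgroup.zpowers a := le_zpowers_of_maximal_isCyclic_normal hP hU hmax C
    fun x hx => by
      obtain ⟨s, hs⟩ := exists_conj_exponent hA x
      have h := dvd_sub_one_of_commute_zpow (k := q) hs (by
        rw [zpow_natCast]; exact (hCmem x).1 hx)
      rw [zpow_natCast, ← hw, hw4] at h
      push_cast at h ⊢
      exact ⟨s, dvd_trans (by norm_num) h, fun _ => h, hs⟩
  have hAC : ∀ x ∈ Subgroup.zpowers a, x * w = w * x := by
    rintro _ ⟨k, rfl⟩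
    exact ((Commute.refl a).pow_right q).zpow_left k
  have hout : ∀ x, x ∉ Subgroup.zpowers a → x * w * x⁻¹ = w⁻¹ := fun x hx => by
    rcases hinv x with h | h
    · exact absurd (hCle ((hCmem x).2 (mul_inv_eq_iff_eq_mul.1 h))) hx
    · exact h
  have hmul : ∀ x y, x ∉ Subgroup.zpowers a → y ∉ Subgroup.zpowers a →
      x * y ∈ Subgroup.zpowers a := fun x y hx hy => by
    apply hCle
    rw [hCmem, ← mul_inv_eq_iff_eq_mul]
    calc x * y * w * (x * y)⁻¹ = x * (y * w * y⁻¹) * x⁻¹ := by group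
      _ = (x * w * x⁻¹)⁻¹ := by rw [hout y hy]; group
      _ = w := by rw [hout x hx, inv_inv]
  refine ⟨a, ?_, ?_⟩
  · obtain ⟨b, hb⟩ : ∃ b, b ∉ Subgroup.zpowers a := by
      by_contra! h
      exact hcyc (eq_top_iff.2 fun x _ => h x)
    rw [Subgroup.index_eq_two_iff_exists_notMem_and]
    exact ⟨b, hb, fun c => or_iff_not_imp_right.2 fun hc => hmul c b hc hb⟩
  · intro x hx
    have hx2 : x ^ 2 ∈ Subgroup.zpowers a := by rw [pow_two]; exact hmul x x hx hx
    -- Otherwise `w` would be a power of `x ^ 2`, hence centralized by `x`.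
    have hnd : ¬ 4 ∣ orderOf (x ^ 2) := by
      intro h
      obtain ⟨k, hk⟩ := mem_zpowers_of_orderOf_dvd hx2 hwA (hw4 ▸ h)
      have hc : x * w = w * x := by
        rw [← hk]
        exact ((Commute.refl x).pow_right 2).zpow_right k
      exact hx (hCle ((hCmem x).2 hc))
    obtain ⟨n, hn⟩ := IsPGroup.iff_orderOf.1 hP x
    have hne2 : orderOf x ≠ 2 := fun h => by
      have hw2 : orderOf (w ^ 2) = 2 := by rw [orderOf_pow, hw4]; norm_num
      have := hU (w ^ 2) x hw2 h
      exact hx ((Subgroup.zpowers_le.2 (pow_mem hwA 2)) this)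
    have hne1 : orderOf x ≠ 1 := fun h => hx ((orderOf_eq_one_iff.1 h) ▸ one_mem _)
    rw [orderOf_pow, hn] at hnd
    rw [hn] at hne1 hne2 ⊢
    match n, hnd, hne1, hne2 with
    | 0, _, h, _ => exact absurd rfl h
    | 1, _, _, h => exact absurd rfl h
    | 2, _, _, _ => rfl
    | n + 3, h, _, _ =>
      exfalso; apply h
      have h2 : (2 ^ (n + 3)).gcd 2 = 2 := Nat.gcd_eq_right ⟨2 ^ (n + 2), by ring⟩
      rw [h2]
      exact ⟨2 ^ n, by rw [show 2 ^ (n + 3) = 2 * (4 * 2 ^ n) by ring]; simp⟩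

/-! ### Abelian normal subgroups of solvable groups -/

/-- The last nontrivial derived subgroup is abelian, so its Sylow subgroups are characteristic in
it. -/
theorem exists_normal_isPGroup_of_isSolvable (G : Type*) [Group G] [Finite G] [Nontrivial G]
    (hG : Group.IsSolvable G) :
    ∃ q : ℕ, q.Prime ∧ ∃ N : Subgroup G, N.Normal ∧ N ≠ ⊥ ∧ IsPGroup q N ∧ IsMulCommutative N := by
  classical
  have hex : ∃ n, derivedSeries G n = ⊥ := hG.solvable
  obtain ⟨k, hk⟩ : ∃ k, Nat.find hex = k + 1 := Nat.exists_eq_succ_of_ne_zero fun h => by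
    have := Nat.find_spec hex
    rw [h, derivedSeries_zero] at this
    exact bot_ne_top this.symm
  set D := derivedSeries G k with hD
  have hDne : D ≠ ⊥ := Nat.find_min hex (by omega)
  have hDc : IsMulCommutative D := by
    have h := Nat.find_spec hex
    rw [hk, derivedSeries_succ, Subgroup.commutator_eq_bot_iff_le_centralizer] at h
    exact Subgroup.le_centralizer_iff_isMulCommutative.1 h
  have hcard : Nat.card D ≠ 1 := fun h => hDne (Subgroup.card_eq_one.1 h)
  have hq := Nat.minFac_prime hcard
  have : Fact (Nat.card D).minFac.Prime := ⟨hq⟩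
  obtain ⟨S⟩ : Nonempty (Sylow (Nat.card D).minFac D) := inferInstance
  have hSn : (S : Subgroup D).Normal := ⟨fun n hn g => by
    rwa [isMulCommutative_iff.1 hDc g n, mul_inv_cancel_right]⟩
  have := S.characteristic_of_normal hSn
  refine ⟨_, hq, (S : Subgroup D).map D.subtype, inferInstance, ?_, S.isPGroup'.map _, ?_⟩
  · rw [Ne, Subgroup.map_eq_bot_iff_of_injective _ D.subtype_injective]
    exact S.ne_bot_of_dvd_card (Nat.minFac_dvd _)
  · rw [isMulCommutative_iff]
    rintro ⟨_, x, hx, rfl⟩ ⟨_, y, hy, rfl⟩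
    exact Subtype.ext (congrArg (fun t : D => (t : G)) (isMulCommutative_iff.1 hDc x y))

/-- Abelian `p`-subgroups of equal order are conjugate. -/
def ConjAbelianPSubgroups (p : ℕ) (G : Type*) [Group G] : Prop :=
  ∀ (n : ℕ) (H K : Subgroup G), IsMulCommutative H → IsMulCommutative K →
    Nat.card H = p ^ n → Nat.card K = p ^ n → AreConjSubgroups H K

/-- All `p`-subgroups of equal order are conjugate. -/
def ConjPSubgroups (p : ℕ) (G : Type*) [Group G] : Prop :=
  ∀ (n : ℕ) (H K : Subgroup G), Nat.card H = p ^ n → Nat.card K = p ^ n → AreConjSubgroups H K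

theorem Subgroup.conj_smul_eq_map {G : Type*} [Group G] (g : G) (H : Subgroup G) :
    MulAut.conj g • H = H.map (MulAut.conj g).toMonoidHom := rfl

theorem Subgroup.map_conj_smul {G G' : Type*} [Group G] [Group G'] (f : G →* G') (g : G)
    (H : Subgroup G) : (MulAut.conj g • H).map f = MulAut.conj (f g) • H.map f := by
  rw [Subgroup.conj_smul_eq_map, Subgroup.conj_smul_eq_map, Subgroup.map_map, Subgroup.map_map]
  congr 1
  ext x
  simp

theorem Subgroup.mem_conj_smul_iff_exists {G : Type*} [Group G] {g x : G} {H : Subgroup G} :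
    x ∈ MulAut.conj g • H ↔ ∃ y ∈ H, g * y * g⁻¹ = x := by
  rw [Subgroup.conj_smul_eq_map, Subgroup.mem_map]
  rfl

theorem Subgroup.card_conj_smul {G : Type*} [Group G] (g : G) (H : Subgroup G) :
    Nat.card (MulAut.conj g • H : Subgroup G) = Nat.card H := by
  rw [Subgroup.conj_smul_eq_map]
  exact Subgroup.card_map_of_injective (MulAut.conj g).injective

/-! ### Factoring out a normal subgroup of order prime to `p` -/

section Quotient

variable {G : Type*} [Group G] {p : ℕ} (N : Subgroup G) [N.Normal]

theorem injOn_mk_of_coprime (hN : p.Coprime (Nat.card N)) {H : Subgroup G} {n : ℕ}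
    (hH : Nat.card H = p ^ n) : Function.Injective ((QuotientGroup.mk' N).comp H.subtype) := by
  rw [injective_iff_map_eq_one]
  intro x hx
  have hxN : (x : G) ∈ N := (QuotientGroup.eq_one_iff _).1 hx
  have h1 : orderOf (x : G) ∣ Nat.card N := Subgroup.orderOf_dvd_natCard N hxN
  have h2 : orderOf (x : G) ∣ p ^ n := hH ▸ Subgroup.orderOf_dvd_natCard H x.2
  have := Nat.eq_one_of_dvd_coprimes (Nat.Coprime.pow_left n hN) h2 h1
  exact Subtype.ext (orderOf_eq_one_iff.1 this)

theorem card_map_mk_of_coprime (hN : p.Coprime (Nat.card N)) {H : Subgroup G} {n : ℕ}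
    (hH : Nat.card H = p ^ n) : Nat.card (H.map (QuotientGroup.mk' N)) = p ^ n := by
  have h := Nat.card_range_of_injective (injOn_mk_of_coprime N hN hH)
  rw [hH] at h
  rw [← h]
  have : (H.map (QuotientGroup.mk' N) : Set (G ⧸ N)) =
      Set.range ((QuotientGroup.mk' N).comp H.subtype) := by
    ext y; simp
  exact Nat.card_congr (Equiv.setCongr this)

theorem card_comap_mk (K : Subgroup (G ⧸ N)) :
    Nat.card (K.comap (QuotientGroup.mk' N)) = Nat.card N * Nat.card K := by
  have h := Subgroup.relIndex_comap (⊥ : Subgroup (G ⧸ N)) (QuotientGroup.mk' N)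
    (K.comap (QuotientGroup.mk' N))
  rw [Subgroup.map_comap_eq_self_of_surjective (QuotientGroup.mk'_surjective N),
    Subgroup.relIndex_bot_left, MonoidHom.comap_bot, QuotientGroup.ker_mk'] at h
  rw [← h, Subgroup.relIndex, ← Nat.card_congr (Subgroup.subgroupOfEquivOfLe
    (QuotientGroup.le_comap_mk' N K)).toEquiv, Subgroup.card_mul_index]

variable [Finite G] [hp : Fact p.Prime]

theorem exists_lift_of_coprime (hN : p.Coprime (Nat.card N)) {K : Subgroup (G ⧸ N)} {n : ℕ}
    (hK : Nat.card K = p ^ n) :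
    ∃ H : Subgroup G, Nat.card H = p ^ n ∧ H.map (QuotientGroup.mk' N) = K := by
  have hcard := card_comap_mk N K
  obtain ⟨S, hS⟩ := Sylow.exists_subgroup_card_pow_prime (G := K.comap (QuotientGroup.mk' N)) p
    (n := n) (by rw [hcard, hK]; exact dvd_mul_left _ _)
  refine ⟨S.map (Subgroup.subtype _), ?_, ?_⟩
  · rw [Subgroup.card_subtype, hS]
  · refine Subgroup.eq_of_le_of_card_ge ?_ ?_
    · rintro _ ⟨_, ⟨x, hx, rfl⟩, rfl⟩
      exact x.2
    · rw [hK, card_map_mk_of_coprime N hN (n := n)]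
      rw [Subgroup.card_subtype, hS]

theorem ConjAbelianPSubgroups.quotient (hN : p.Coprime (Nat.card N))
    (h : ConjAbelianPSubgroups p G) : ConjAbelianPSubgroups p (G ⧸ N) := by
  intro n H K hHc hKc hH hK
  have hcomm : ∀ L : Subgroup G, Nat.card L = p ^ n →
      IsMulCommutative (L.map (QuotientGroup.mk' N)) → IsMulCommutative L := by
    intro L hL hLc
    rw [isMulCommutative_iff] at hLc ⊢
    intro x y
    apply injOn_mk_of_coprime N hN hL
    rw [map_mul, map_mul]
    exact congrArg Subtype.val (hLc ⟨_, Subgroup.mem_map_of_mem _ x.2⟩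
      ⟨_, Subgroup.mem_map_of_mem _ y.2⟩)
  obtain ⟨H', hH', rfl⟩ := exists_lift_of_coprime N hN hH
  obtain ⟨K', hK', rfl⟩ := exists_lift_of_coprime N hN hK
  obtain ⟨g, rfl⟩ := h n H' K' (hcomm _ hH' hHc) (hcomm _ hK' hKc) hH' hK'
  exact ⟨QuotientGroup.mk' N g, (Subgroup.map_conj_smul _ _ _).symm⟩

theorem ConjPSubgroups.of_quotient (hN : p.Coprime (Nat.card N))
    (h : ConjPSubgroups p (G ⧸ N)) : ConjPSubgroups p G := by
  intro n H K hH hK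
  obtain ⟨g, hg⟩ := h n _ _ (card_map_mk_of_coprime N hN hH) (card_map_mk_of_coprime N hN hK)
  obtain ⟨g, rfl⟩ := QuotientGroup.mk'_surjective N g
  rw [← Subgroup.map_conj_smul] at hg
  set H' := MulAut.conj g • H with hH'
  have hcH' : Nat.card H' = p ^ n := (Subgroup.card_conj_smul g H).trans hH
  -- `M = KN` has order `|N| * p ^ n` and contains both `H'` and `K`, which are therefore Sylow in
  -- it.
  set M := (K.map (QuotientGroup.mk' N)).comap (QuotientGroup.mk' N) with hM
  have hcM : Nat.card M = Nat.card N * p ^ n := by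
    rw [hM, card_comap_mk, card_map_mk_of_coprime N hN hK]
  have hle : ∀ L : Subgroup G, L.map (QuotientGroup.mk' N) = K.map (QuotientGroup.mk' N) →
      L ≤ M := fun L hL => by
    rw [hM, ← hL]; exact Subgroup.le_comap_map _ _
  have hfac : (Nat.card M).factorization p = n := by
    rw [hcM, Nat.factorization_mul Nat.card_pos.ne' (pow_ne_zero _ hp.out.ne_zero)]
    simp [hp.out.factorization_self, Nat.factorization_eq_zero_of_not_dvd
      ((Nat.Prime.coprime_iff_not_dvd hp.out).1 hN)]
  have hcard : ∀ L : Subgroup G, L ≤ M → Nat.card L = p ^ n →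
      Nat.card (L.subgroupOf M) = p ^ (Nat.card M).factorization p := fun L hL hLc => by
    rw [hfac, ← hLc]
    exact Nat.card_congr (Subgroup.subgroupOfEquivOfLe hL).toEquiv
  let S := Sylow.ofCard (H'.subgroupOf M) (hcard H' (hle H' hg) hcH')
  let T := Sylow.ofCard (K.subgroupOf M) (hcard K (hle K rfl) hK)
  obtain ⟨m, hm⟩ := MulAction.exists_smul_eq M S T
  have hm' : MulAut.conj m • H'.subgroupOf M = K.subgroupOf M := congrArg Sylow.toSubgroup hm
  refine ⟨m * g, ?_⟩
  rw [map_mul, mul_smul, ← hH']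
  have := congrArg (Subgroup.map M.subtype) hm'
  rw [Subgroup.map_conj_smul, Subgroup.map_subgroupOf_eq_of_le (hle H' hg),
    Subgroup.map_subgroupOf_eq_of_le (hle K rfl)] at this
  exact this

end Quotient

/-! ### Groups without nontrivial normal `q`-subgroups, `q ≠ p` -/

section Core

variable {G : Type*} [Group G] {p : ℕ}

theorem ConjAbelianPSubgroups.exists_conj_zpowers (h : ConjAbelianPSubgroups p G) {n : ℕ} {x y : G}
    (hx : orderOf x = p ^ n) (hy : orderOf y = p ^ n) :
    ∃ g : G, MulAut.conj g • Subgroup.zpowers x = Subgroup.zpowers y :=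
  h n _ _ inferInstance inferInstance (by rw [Nat.card_zpowers, hx]) (by rw [Nat.card_zpowers, hy])

theorem ConjAbelianPSubgroups.mem_normal (h : ConjAbelianPSubgroups p G) {n : ℕ} {x y : G}
    (hx : orderOf x = p ^ n) (hy : orderOf y = p ^ n) {N : Subgroup G} (hN : N.Normal)
    (hxN : x ∈ N) : y ∈ N := by
  obtain ⟨g, hg⟩ := h.exists_conj_zpowers hx hy
  obtain ⟨t, ht, rfl⟩ := Subgroup.mem_conj_smul_iff_exists.1 (hg ▸ Subgroup.mem_zpowers y)
  exact hN.conj_mem _ (Subgroup.zpowers_le.2 hxN ht) g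

theorem pow_eq_one_or_exists_pow_orderOf_eq [hp : Fact p.Prime] {x : G} {k : ℕ}
    (hx : orderOf x = p ^ k) : x ^ p = 1 ∨ ∃ m, orderOf (x ^ m) = p ^ 2 := by
  by_cases hk : k ≤ 1
  · left
    apply orderOf_dvd_iff_pow_eq_one.1
    rw [hx]
    simpa using pow_dvd_pow p hk
  · right
    refine ⟨p ^ (k - 2), ?_⟩
    have hd : p ^ (k - 2) ∣ orderOf x := hx ▸ pow_dvd_pow p (by omega)
    rw [orderOf_pow_of_dvd (pow_ne_zero _ hp.out.ne_zero) hd, hx,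
      Nat.pow_div (by omega) hp.out.pos]
    congr 1
    omega

theorem ConjPSubgroups.of_isMulCommutative (h : ConjAbelianPSubgroups p G)
    (hc : ∀ H : Subgroup G, IsPGroup p H → IsMulCommutative H) : ConjPSubgroups p G :=
  fun n H K hH hK => h n H K (hc H (IsPGroup.of_card hH)) (hc K (IsPGroup.of_card hK)) hH hK

variable [Finite G] [hp : Fact p.Prime]

theorem exists_orderOf_eq_prime_of_ne_bot {N : Subgroup G} (hNp : IsPGroup p N) (hN : N ≠ ⊥) :
    ∃ x ∈ N, orderOf x = p := by
  obtain ⟨x, -, hx, -⟩ := hNp.exists_mem_center_of_normal ⊤ (by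
    have := (Subgroup.nontrivial_iff_ne_bot N).2 hN
    exact top_ne_bot)
  exact ⟨x, x.2, by rwa [Subgroup.orderOf_coe]⟩

/-- `⟨z, y⟩` contains an abelian group of order `p ^ 2` and exponent `p`, which cannot be conjugate
to a cyclic one. -/
theorem ConjAbelianPSubgroups.isMulCommutative_of_not_mem_zpowers (h : ConjAbelianPSubgroups p G)
    {N : Subgroup G} (hN : N.Normal) (hNp : IsPGroup p N) (hNc : IsMulCommutative N)
    (hNb : N ≠ ⊥) {z y : G} (hz : orderOf z = p) (hy : orderOf y = p) (hzy : z * y = y * z)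
    (hyz : y ∉ Subgroup.zpowers z) (H : Subgroup G) (hH : IsPGroup p H) : IsMulCommutative H := by
  set E := Subgroup.closure {z, y} with hE
  have hEc : IsMulCommutative E := Subgroup.isMulCommutative_closure (by
    rintro a (rfl | rfl) b (rfl | rfl)
    · rfl
    · exact hzy
    · exact hzy.symm
    · rfl)
  have hzE : z ∈ E := Subgroup.subset_closure (by simp)
  have hyE : y ∈ E := Subgroup.subset_closure (by simp)
  have hEexp : ∀ t ∈ E, t ^ p = 1 := by
    intro t ht
    refine Subgroup.closure_induction (p := fun t _ => t ^ p = 1) ?_ (one_pow p) ?_ ?_ ht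
    · rintro a (rfl | rfl)
      · exact hz ▸ pow_orderOf_eq_one a
      · exact hy ▸ pow_orderOf_eq_one a
    · intro a b ha hb ha1 hb1
      have : Commute a b := congrArg Subtype.val (isMulCommutative_iff.1 hEc ⟨a, ha⟩ ⟨b, hb⟩)
      rw [this.mul_pow, ha1, hb1, one_mul]
    · intro a _ ha
      rw [inv_pow, ha, inv_one]
  have hEp : IsPGroup p E := fun t => ⟨1, Subtype.ext (by simpa using hEexp t t.2)⟩
  obtain ⟨k, hk⟩ := IsPGroup.iff_card.1 hEp
  have hk2 : 2 ≤ k := by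
    by_contra hk2
    have hle : Subgroup.zpowers z ≤ E := by simpa using hzE
    have := Subgroup.eq_of_le_of_card_ge hle (by
      rw [hk, Nat.card_zpowers, hz]
      simpa using Nat.pow_le_pow_right hp.out.pos (by omega : k ≤ 1))
    exact hyz (this ▸ hyE)
  obtain ⟨F, hF⟩ := Sylow.exists_subgroup_card_pow_prime_of_le_card (n := 2) hp.out hEp
    (by rw [hk]; exact Nat.pow_le_pow_right hp.out.pos hk2)
  have hFc : Nat.card (F.map E.subtype) = p ^ 2 := by rw [Subgroup.card_subtype, hF]
  have hFcomm : IsMulCommutative (F.map E.subtype) := by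
    rw [isMulCommutative_iff]
    rintro ⟨_, x, hx, rfl⟩ ⟨_, y, hy, rfl⟩
    exact Subtype.ext (congrArg (fun t : E => (t : G)) (isMulCommutative_iff.1 hEc x y))
  have hno : ∀ x : G, orderOf x ≠ p ^ 2 := by
    intro x hx
    obtain ⟨g, hg⟩ := h 2 _ (Subgroup.zpowers x) hFcomm inferInstance hFc
      (by rw [Nat.card_zpowers, hx])
    obtain ⟨t, ⟨t, -, rfl⟩, ht⟩ := Subgroup.mem_conj_smul_iff_exists.1 (hg ▸ Subgroup.mem_zpowers x)
    have hxp : x ^ p = 1 := by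
      rw [← ht, conj_pow, Subgroup.subtype_apply, hEexp _ t.2]; simp
    have := Nat.le_of_dvd hp.out.pos (hx ▸ orderOf_dvd_of_pow_eq_one hxp)
    nlinarith [hp.out.two_le]
  obtain ⟨n, hnN, hn⟩ := exists_orderOf_eq_prime_of_ne_bot hNp hNb
  have hHN : H ≤ N := by
    intro x hxH
    obtain ⟨k, hk⟩ := IsPGroup.iff_orderOf.1 hH ⟨x, hxH⟩
    rw [Subgroup.orderOf_mk] at hk
    rcases pow_eq_one_or_exists_pow_orderOf_eq hk with hx | ⟨m, hm⟩
    · by_cases hx1 : x = 1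
      · exact hx1 ▸ one_mem N
      · exact h.mem_normal (n := 1) (by rw [hn, pow_one])
          (by rw [orderOf_eq_prime hx hx1, pow_one]) hN hnN
    · exact absurd hm (hno _)
  rw [isMulCommutative_iff] at hNc ⊢
  exact fun x y => Subtype.ext
    (congrArg (fun t : N => (t : G)) (hNc ⟨x, hHN x.2⟩ ⟨y, hHN y.2⟩))

/-- A central element of order `p` in `P` commutes with both `x` and `y`, and so links them. -/
theorem Sylow.mem_zpowers_of_orderOf_eq_prime
    (hcyc : ∀ z y : G, orderOf z = p → orderOf y = p → z * y = y * z → y ∈ Subgroup.zpowers z)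
    (P : Sylow p G) (x y : P) (hx : orderOf x = p) (hy : orderOf y = p) :
    y ∈ Subgroup.zpowers x := by
  have htop : (⊤ : Subgroup P) ≠ ⊥ := by
    intro h
    have : x = 1 := by simpa [h] using Subgroup.mem_top x
    rw [this, orderOf_one] at hx
    exact hp.out.one_lt.ne hx
  obtain ⟨z, -, hz, hzc⟩ := P.isPGroup'.exists_mem_center_of_normal ⊤ htop
  rw [Subgroup.mem_center_iff] at hzc
  have key : ∀ u v : P, orderOf u = p → orderOf v = p → u * v = v * u →
      v ∈ Subgroup.zpowers u := by
    intro u v hu hv huv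
    obtain ⟨k, hk⟩ := hcyc u v (by rwa [Subgroup.orderOf_coe]) (by rwa [Subgroup.orderOf_coe])
      (congrArg Subtype.val huv)
    exact ⟨k, Subtype.ext hk⟩
  exact Subgroup.zpowers_le.2 (key x z hx hz (hzc x)) (key z y hz hy (hzc y).symm)

/-- Otherwise all normal 2-subgroups have exponent 2, which makes `N = ⟨z⟩` central and the largest
of them. Lift a nontrivial normal `q`-subgroup of `G ⧸ N` to `M`. For `q = 2`, `M` is too large a
normal 2-subgroup; for `q` odd, its Sylow `q`-subgroup is normal in `G`, contrary to `hq`. -/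
theorem exists_normal_two_group_orderOf_eq_four {G : Type*} [Group G] [Finite G]
    (hG : Group.IsSolvable G)
    (hcyc : ∀ z y : G, orderOf z = 2 → orderOf y = 2 → z * y = y * z → y ∈ Subgroup.zpowers z)
    (hq : ∀ q : ℕ, q.Prime → q ≠ 2 → ∀ Q : Subgroup G, Q.Normal → IsPGroup q Q → Q = ⊥)
    {N : Subgroup G} (hN : N.Normal) (hNp : IsPGroup 2 N) (hNc : IsMulCommutative N)
    (hNb : N ≠ ⊥) {x : G} (hx : orderOf x = 4) :
    ∃ F : Subgroup G, F.Normal ∧ IsPGroup 2 F ∧ ∃ t ∈ F, orderOf t = 4 := by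
  by_contra! hno
  have hsq : ∀ F : Subgroup G, F.Normal → IsPGroup 2 F → ∀ t ∈ F, t ^ 2 = 1 := by
    intro F hF hFp t ht
    obtain ⟨k, hk⟩ := IsPGroup.iff_orderOf.1 hFp ⟨t, ht⟩
    rw [Subgroup.orderOf_mk] at hk
    rcases pow_eq_one_or_exists_pow_orderOf_eq hk with h | ⟨m, hm⟩
    · exact h
    · exact absurd hm (hno F hF hFp _ (pow_mem ht m))
  obtain ⟨z, hzN, hz⟩ := exists_orderOf_eq_prime_of_ne_bot hNp hNb
  have hz2 : z ^ 2 = 1 := hz ▸ pow_orderOf_eq_one z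
  have hzz : ∀ t ∈ Subgroup.zpowers z, t = 1 ∨ t = z := by
    rintro _ ⟨k, rfl⟩
    simp only
    rcases Int.even_or_odd' k with ⟨j, rfl | rfl⟩
    · left; rw [zpow_mul]; norm_cast; rw [hz2, one_zpow]
    · right; rw [zpow_add, zpow_mul]; norm_cast; rw [hz2, one_zpow, one_mul, pow_one]
  have horder : ∀ t : G, t ^ 2 = 1 → z * t = t * z → t ∈ Subgroup.zpowers z := by
    intro t ht hzt
    by_cases h1 : t = 1
    · exact h1 ▸ one_mem _
    · exact hcyc z t hz (orderOf_eq_prime ht h1) hzt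
  have hzc : ∀ g : G, z * g = g * z := by
    intro g
    have hgz := hN.conj_mem z hzN g
    have hmem := horder _ (hsq N hN hNp _ hgz)
      (congrArg Subtype.val (isMulCommutative_iff.1 hNc ⟨z, hzN⟩ ⟨_, hgz⟩))
    rcases hzz _ hmem with h | h
    · have : z = 1 := by simpa using h
      rw [this]; simp
    · exact (mul_inv_eq_iff_eq_mul.1 h).symm
  have hzle : Subgroup.zpowers z ≤ N := by simpa using hzN
  have hle : ∀ F : Subgroup G, F.Normal → IsPGroup 2 F → F ≤ Subgroup.zpowers z :=
    fun F hF hFp t ht => horder t (hsq F hF hFp t ht) (hzc t)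
  have hNz := le_antisymm (hle N hN hNp) hzle
  have hnt : Nontrivial (G ⧸ N) := by
    refine ⟨(x : G ⧸ N), 1, fun h => ?_⟩
    have := hsq N hN hNp x ((QuotientGroup.eq_one_iff x).1 h)
    have := Nat.le_of_dvd (by norm_num) (orderOf_dvd_of_pow_eq_one this)
    omega
  obtain ⟨q, hqp, D, hD, hDb, hDp, -⟩ := exists_normal_isPGroup_of_isSolvable (G ⧸ N)
    (Group.isSolvable_of_surjective (QuotientGroup.mk'_surjective N))
  have : Fact q.Prime := ⟨hqp⟩
  set M := D.comap (QuotientGroup.mk' N) with hM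
  have hMn : M.Normal := hD.comap _
  have hDq : q ∣ Nat.card D := hDp.card_eq_or_dvd.resolve_left fun h =>
    hDb (Subgroup.card_eq_one.1 h)
  have hMcard : Nat.card M = Nat.card N * Nat.card D := card_comap_mk N D
  by_cases hq2 : q = 2
  · subst hq2
    have hMp : IsPGroup 2 M :=
      hDp.comap_of_ker_isPGroup _ (by rw [QuotientGroup.ker_mk']; exact hNp)
    have hMN := hle M hMn hMp
    rw [← hNz] at hMN
    have h1 := Subgroup.card_le_of_le hMN
    have h2 := Nat.le_of_dvd Nat.card_pos hDq
    have h3 : 0 < Nat.card N := Nat.card_pos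
    nlinarith
  · obtain ⟨S⟩ : Nonempty (Sylow q M) := inferInstance
    have hNM : N ≤ M := QuotientGroup.le_comap_mk' N D
    have hnorm : N.subgroupOf M ≤ Subgroup.normalizer ((S : Subgroup M) : Set M) := by
      intro t ht
      rw [Subgroup.mem_subgroupOf, hNz] at ht
      have htc : ∀ g : M, t * g = g * t := fun g => by
        apply Subtype.ext
        rcases hzz _ ht with h | h
        · simp [h]
        · simpa [h] using hzc g
      rw [Subgroup.mem_normalizer_iff]
      intro g
      rw [htc g, mul_inv_cancel_right]
    have hidx : (N.subgroupOf M).index = Nat.card D := by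
      have h := (N.subgroupOf M).card_mul_index
      rw [hMcard, Nat.card_congr (Subgroup.subgroupOfEquivOfLe hNM).toEquiv] at h
      exact Nat.eq_of_mul_eq_mul_left Nat.card_pos h
    obtain ⟨k, hk⟩ := IsPGroup.iff_card.1 hDp
    have hd1 : (Subgroup.normalizer ((S : Subgroup M) : Set M)).index ∣ q ^ k :=
      hk ▸ hidx ▸ Subgroup.index_dvd_of_le hnorm
    have hd2 : (Subgroup.normalizer ((S : Subgroup M) : Set M)).index ∣ (S : Subgroup M).index :=
      Subgroup.index_dvd_of_le Subgroup.le_normalizer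
    have hcop : (q ^ k).Coprime (S : Subgroup M).index :=
      ((Nat.Prime.coprime_iff_not_dvd hqp).2 S.not_dvd_index).pow_left k
    -- The normalizer contains both the central `N`, of index a power of `q`, and `S`, of index
    -- prime to `q`.
    have hone := Nat.eq_one_of_dvd_coprimes hcop hd1 hd2
    have hSn : (S : Subgroup M).Normal := Subgroup.normalizer_eq_top_iff.1
      (Subgroup.index_eq_one.1 hone)
    have := S.characteristic_of_normal hSn
    have hbot := hq q hqp hq2 ((S : Subgroup M).map M.subtype) inferInstance (S.isPGroup'.map _)
    rw [Subgroup.map_eq_bot_iff_of_injective _ M.subtype_injective] at hbot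
    exact S.ne_bot_of_dvd_card (hMcard ▸ hDq.mul_left _) hbot

theorem isMulCommutative_of_card_eq_prime_pow {H : Type*} [Group H] [Finite H] {n : ℕ}
    (h : Nat.card H = p ^ n) (hn : n ≤ 2) : IsMulCommutative H := by
  interval_cases n
  · have := (Nat.card_eq_one_iff_unique.1 (by simpa using h)).1
    exact isMulCommutative_iff.2 fun a b => Subsingleton.elim _ _
  · have := isCyclic_of_prime_card (p := p) (by simpa using h)
    exact IsCyclic.isMulCommutative
  · exact IsPGroup.isMulCommutative_of_card_eq_prime_sq h

theorem ConjPSubgroups.of_isCyclic_sylow (h : ConjAbelianPSubgroups p G)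
    (P : Sylow p G) (hP : IsCyclic P) : ConjPSubgroups p G := by
  refine .of_isMulCommutative h fun H hH => ?_
  obtain ⟨Q, hQ⟩ := hH.exists_le_sylow
  have := (P.equiv Q).isCyclic.1 hP
  have : IsCyclic H := Subgroup.isCyclic_of_le hQ
  exact IsCyclic.isMulCommutative

theorem ConjPSubgroups.of_card_sylow_dvd (h : ConjAbelianPSubgroups p G)
    (P : Sylow p G) (hP : Nat.card P ∣ p ^ 3) : ConjPSubgroups p G := by
  intro n H K hH hK
  by_cases hn : n ≤ 2
  · exact h n H K (isMulCommutative_of_card_eq_prime_pow hH hn)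
      (isMulCommutative_of_card_eq_prime_pow hK hn) hH hK
  have key : ∀ L : Subgroup G, Nat.card L = p ^ n → ∃ Q : Sylow p G, L = Q := by
    intro L hL
    obtain ⟨Q, hQ⟩ := (IsPGroup.of_card hL).exists_le_sylow
    refine ⟨Q, Subgroup.eq_of_le_of_card_ge hQ ?_⟩
    rw [hL, Nat.card_congr (Q.equiv P).toEquiv]
    exact (Nat.le_of_dvd (pow_pos hp.out.pos _) hP).trans
      (Nat.pow_le_pow_right hp.out.pos (by omega))
  obtain ⟨Q, rfl⟩ := key H hH
  obtain ⟨R, rfl⟩ := key K hK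
  obtain ⟨g, hg⟩ := MulAction.exists_smul_eq G Q R
  exact ⟨g, congrArg Sylow.toSubgroup hg⟩

/-- `F` contains every element of order 4, hence everything outside `⟨a⟩`, hence `a`. If `8 ∣
orderOf a`, each conjugate of `a` lies in `P` and has order other than 4, so it lies in `⟨a⟩`. Then
the order 4 subgroup of `⟨a⟩` cannot be conjugate to one generated outside `⟨a⟩`. -/
theorem not_eight_dvd_orderOf {G : Type*} [Group G] [Finite G] (h : ConjAbelianPSubgroups 2 G)
    (P : Sylow 2 G) {a : P} (ha : (Subgroup.zpowers a).index = 2)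
    (hout : ∀ x ∉ Subgroup.zpowers a, orderOf x = 4) {F : Subgroup G} (hF : F.Normal)
    (hFp : IsPGroup 2 F) {t : G} (htF : t ∈ F) (ht : orderOf t = 4) : ¬ 8 ∣ orderOf a := by
  intro h8
  have hFP : F ≤ P := hFp.le_sylow_of_normal P
  obtain ⟨x, hx⟩ : ∃ x, x ∉ Subgroup.zpowers a := by
    by_contra! hall
    rw [(eq_top_iff.2 fun x _ => hall x : Subgroup.zpowers a = ⊤), Subgroup.index_top] at ha
    omega
  have hmem : ∀ y ∉ Subgroup.zpowers a, (y : G) ∈ F := fun y hy =>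
    h.mem_normal (n := 2) (by rw [ht]; norm_num)
      (by rw [Subgroup.orderOf_coe, hout y hy]; norm_num) hF htF
  have haF : (a : G) ∈ F := by
    have := hmem (x * a) fun hxa => hx
      ((Subgroup.mul_mem_cancel_right _ (Subgroup.mem_zpowers a)).1 hxa)
    exact (Subgroup.mul_mem_cancel_left _ (hmem x hx)).1 this
  obtain ⟨q, hq⟩ : 4 ∣ orderOf a := dvd_trans (by norm_num) h8
  have hpos := orderOf_pos a
  have hw4 : orderOf (a ^ q) = 4 := by
    rw [orderOf_pow_of_dvd (by rintro rfl; omega) ⟨4, by rw [hq, mul_comm]⟩, hq,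
      Nat.mul_div_cancel _ (by rcases q with _ | q <;> omega)]
  obtain ⟨g, hg⟩ := h.exists_conj_zpowers (n := 2) (x := ((a ^ q : P) : G)) (y := (x : G))
    (by rw [Subgroup.orderOf_coe, hw4]; norm_num)
    (by rw [Subgroup.orderOf_coe, hout x hx]; norm_num)
  have hgaP : g * a * g⁻¹ ∈ P := hFP (hF.conj_mem _ haF g)
  have hga : (⟨g * a * g⁻¹, hgaP⟩ : P) ∈ Subgroup.zpowers a := by
    by_contra hcon
    have h1 := hout _ hcon
    have h2 : orderOf (g * a * g⁻¹) = orderOf (a : G) := (MulAut.conj g).orderOf_eq (a : G)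
    rw [Subgroup.orderOf_mk, h2, Subgroup.orderOf_coe] at h1
    omega
  obtain ⟨_, ⟨k, rfl⟩, hk⟩ := Subgroup.mem_conj_smul_iff_exists.1
    (hg ▸ Subgroup.mem_zpowers (x : G))
  apply hx
  have : x = ((⟨g * a * g⁻¹, hgaP⟩ : P) ^ q) ^ k := by
    apply Subtype.ext
    rw [← hk]
    push_cast
    rw [conj_pow, conj_zpow]
  rw [this]
  exact zpow_mem (pow_mem hga q) k

theorem ConjAbelianPSubgroups.conjPSubgroups_of_no_coprime_normal (hG : Group.IsSolvable G)
    (h : ConjAbelianPSubgroups p G)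
    (hq : ∀ q : ℕ, q.Prime → q ≠ p → ∀ Q : Subgroup G, Q.Normal → IsPGroup q Q → Q = ⊥) :
    ConjPSubgroups p G := by
  rcases subsingleton_or_nontrivial G with hs | hnt
  · exact fun n H K _ _ => ⟨1, Subsingleton.elim _ _⟩
  obtain ⟨q, hqp, N, hN, hNb, hNp, hNc⟩ := exists_normal_isPGroup_of_isSolvable G hG
  obtain rfl : q = p := by
    by_contra hne
    exact hNb (hq q hqp hne N hN hNp)
  by_cases hcyc : ∀ z y : G, orderOf z = q → orderOf y = q → z * y = y * z →
      y ∈ Subgroup.zpowers z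
  swap
  · push Not at hcyc
    obtain ⟨z, y, hz, hy, hzy, hyz⟩ := hcyc
    exact .of_isMulCommutative h
      (h.isMulCommutative_of_not_mem_zpowers hN hNp hNc hNb hz hy hzy hyz)
  obtain ⟨P⟩ : Nonempty (Sylow q G) := inferInstance
  have hU := P.mem_zpowers_of_orderOf_eq_prime hcyc
  by_cases hq2 : q = 2
  swap
  · exact .of_isCyclic_sylow h P (P.isPGroup'.isCyclic_of_odd hq2 hU)
  subst hq2
  rcases P.isPGroup'.two_isCyclic_or hU with hP | ⟨a, ha, hout⟩
  · exact .of_isCyclic_sylow h P hP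
  obtain ⟨x, hx⟩ : ∃ x, x ∉ Subgroup.zpowers a := by
    by_contra! hall
    rw [(eq_top_iff.2 fun x _ => hall x : Subgroup.zpowers a = ⊤), Subgroup.index_top] at ha
    omega
  obtain ⟨F, hF, hFp, t, htF, ht⟩ := exists_normal_two_group_orderOf_eq_four hG hcyc hq hN hNp hNc
    hNb (x := (x : G)) (by rw [Subgroup.orderOf_coe, hout x hx])
  have h8 := not_eight_dvd_orderOf h P ha hout hF hFp htF ht
  apply ConjPSubgroups.of_card_sylow_dvd h P
  obtain ⟨n, hn⟩ := IsPGroup.iff_orderOf.1 P.isPGroup' a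
  have hn2 : n ≤ 2 := by
    by_contra hn2
    exact h8 (hn ▸ pow_dvd_pow 2 (by omega : 3 ≤ n))
  rw [← (Subgroup.zpowers a).card_mul_index, ha, Nat.card_zpowers, hn]
  exact pow_dvd_pow 2 (by omega : n + 1 ≤ 3)

end Core

/-! ### Induction on the group order -/

theorem ConjAbelianPSubgroups.conjPSubgroups {p : ℕ} [hp : Fact p.Prime] (G : Type*) [Group G]
    [Finite G] (hG : Group.IsSolvable G) (h : ConjAbelianPSubgroups p G) :
    ConjPSubgroups p G := by
  induction hn : Nat.card G using Nat.strong_induction_on generalizing G with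
  | _ n ih =>
    by_cases hq : ∀ q : ℕ, q.Prime → q ≠ p → ∀ Q : Subgroup G, Q.Normal → IsPGroup q Q → Q = ⊥
    · exact h.conjPSubgroups_of_no_coprime_normal hG hq
    push Not at hq
    obtain ⟨q, hqp, hne, N, hN, hNq, hNb⟩ := hq
    have : Fact q.Prime := ⟨hqp⟩
    obtain ⟨k, hk⟩ := IsPGroup.iff_card.1 hNq
    have hcop : p.Coprime (Nat.card N) := by
      rw [hk]
      exact ((Nat.coprime_primes hp.out hqp).2 hne.symm).pow_right k
    refine .of_quotient N hcop (ih _ ?_ (G ⧸ N) (Group.isSolvable_of_surjective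
      (QuotientGroup.mk'_surjective N)) (h.quotient N hcop) rfl)
    rw [← hn, N.card_eq_card_quotient_mul_card_subgroup]
    have h1 : Nat.card N ≠ 1 := fun h => hNb (Subgroup.card_eq_one.1 h)
    have h2 : 0 < Nat.card N := Nat.card_pos
    exact lt_mul_of_one_lt_right Nat.card_pos (by omega)

theorem theorem15 (G : Type*) [Group G] [Finite G] (hsolv : Group.IsSolvable G) (hA : IsAPi G) :
    IsBPi G := by
  intro p n hp
  have : Fact p.Prime := ⟨hp⟩
  exact ConjAbelianPSubgroups.conjPSubgroups G hsolv (fun m => hA p m hp) n
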